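/- Let $\mathcal X$ be a Polish space, $\mathcal Y\subseteq\mathbb R$ closed, both with their Borel $\sigma$-algebras. Let $L:\mathcal X\times\mathcal Y\times\mathbb R\to[0,\infty)$ be continuous, with $L(x,y,y)=0$ and $t\mapsto L(x,y,t)$ convex for all $(x,y)\in\mathcal X\times\mathcal Y$, and suppose that for some constant $|L|_1\in(0,\infty)$, $|L(x,y,t)-L(x,y,t')|\le |L|_1|t-t'|$ for all $x,y,t,t'$. Let $k:\mathcal X\times\mathcal X\to\mathbb R$ be a bounded continuous kernel with (real) reproducing kernel Hilbert space $H$, let $\lambda>0$ be fixed, and let $P$ be a probability measure on $\mathcal X\times\mathcal Y$. Put $L^*(x,y,t)=L(x,y,t)-L(x,y,0)$ and, for $f\in H$ and $\ell\in\{L,L^*\}$, $$\mathcal R_{\ell,P}(f)=\int \ell(x,y,f(x))\,P(d(x,y)),\qquad \mathcal R_{\ell,P,\lambda}(f)=\mathcal R_{\ell,P}(f)+\lambda\|f\|_H^2 ,$$ where $\mathcal R_{L,P}(f)\in[0,\infty]$. Let $(X_i,Y_i)$, $i\ge1$, be independent $\mathcal X\times\mathcal Y$-valued random variables on a probability space,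 each with distribution $P$, and let $\mathbf D_n=((X_1,Y_1),\dots,(X_n,Y_n))$. Then $\mathcal R_{L^*,P}(f)$ is well defined and finite for every $f\in H$; $\mathcal R_{L^*,P,\lambda}$ has a unique minimizer $f_{L^*,P,\lambda}$ in $H$; for every $n\ge1$ the function $f\mapsto\frac1n\sum_{i=1}^n L^*(X_i,Y_i,f(X_i))+\lambda\|f\|_H^2$ has a unique minimizer $f_{L^*,\mathbf D_n,\lambda}$ in $H$, which is an $H$-valued random variable; and almost surely (a) $\lim_{n\to\infty}\|f_{L^*,\mathbf D_n,\lambda}-f_{L^*,P,\lambda}\|_H=0$; (b) $\lim_{n\to\infty}\sup_{x\in\mathcal X}|f_{L^*,\mathbf D_n,\lambda}(x)-f_{L^*,P,\lambda}(x)|=0$; (c) $\lim_{n\to\infty}\mathcal R_{L^*,P,\lambda}(f_{L^*,\mathbf D_n,\lambda})=\mathcal R_{L^*,P,\lambda}(f_{L^*,P,\lambda})$; (d) $\lim_{n\to\infty}\mathcal R_{L^*,P}(f_{L^*,\mathbf D_n,\lambda})=\mathcal R_{L^*,P}(f_{L^*,P,\lambda})$. If a support vector machine $f_{L,P,\lambda}$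 exists, that is, an element of $H$ at which $\mathcal R_{L,P,\lambda}$ is finite and minimal over $H$, then it is unique, for every $n\ge1$ the function $f\mapsto\frac1n\sum_{i=1}^n L(X_i,Y_i,f(X_i))+\lambda\|f\|_H^2$ has a unique minimizer $f_{L,\mathbf D_n,\lambda}$ in $H$, which is an $H$-valued random variable, and (a)–(d) also hold almost surely with $L$ in place of $L^*$ throughout. -/

import Mathlib

open MeasureTheory ProbabilityTheory Filter Topology
open scoped ENNReal

noncomputable section

namespace SVM

/-- The shifted loss `L*(x, y, t) = L(x, y, t) - L(x, y, 0)`. -/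
def shiftedLoss {X Y : Type*} (L : X → Y → ℝ → ℝ) : X → Y → ℝ → ℝ :=
  fun x y t => L x y t - L x y 0

/-- The risk of `f` for a nonnegative loss `L`, as an extended nonnegative number. -/
def risk {X Y : Type*} [MeasurableSpace X] [MeasurableSpace Y]
    (L : X → Y → ℝ → ℝ) (P : Measure (X × Y)) (f : X → ℝ) : ℝ≥0∞ :=
  ∫⁻ z, ENNReal.ofReal (L z.1 z.2 (f z.1)) ∂P

/-- The risk of `f` for the real-valued shifted loss `L*`. -/
def riskStar {X Y : Type*} [MeasurableSpace X] [MeasurableSpace Y]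
    (L : X → Y → ℝ → ℝ) (P : Measure (X × Y)) (f : X → ℝ) : ℝ :=
  ∫ z, shiftedLoss L z.1 z.2 (f z.1) ∂P

section RKHS

variable {X Y H : Type*} [NormedAddCommGroup H] [InnerProductSpace ℝ H] [RKHS ℝ H X ℝ]

/-- The regularized `L`-risk `R_{L,P}(f) + lam * ‖f‖²`. -/
def regRisk [MeasurableSpace X] [MeasurableSpace Y]
    (L : X → Y → ℝ → ℝ) (P : Measure (X × Y)) (lam : ℝ) (f : H) : ℝ≥0∞ :=
  risk L P f + ENNReal.ofReal (lam * ‖f‖ ^ 2)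

/-- The regularized `L*`-risk `R_{L*,P}(f) + lam * ‖f‖²`. -/
def regRiskStar [MeasurableSpace X] [MeasurableSpace Y]
    (L : X → Y → ℝ → ℝ) (P : Measure (X × Y)) (lam : ℝ) (f : H) : ℝ :=
  riskStar L P f + lam * ‖f‖ ^ 2

/-- `f` is a support vector machine for `L`: its regularized `L`-risk is finite and minimal in `H`.
(Without finiteness every `f` would qualify when all risks are infinite.) -/
def IsSVM [MeasurableSpace X] [MeasurableSpace Y]
    (L : X → Y → ℝ → ℝ) (P : Measure (X × Y)) (lam : ℝ) (f : H) : Prop :=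
  regRisk L P lam f ≠ ∞ ∧ ∀ g : H, regRisk L P lam f ≤ regRisk L P lam g

/-- `f` is a support vector machine for `L*`: it minimizes the regularized `L*`-risk in `H`. -/
def IsSVMStar [MeasurableSpace X] [MeasurableSpace Y]
    (L : X → Y → ℝ → ℝ) (P : Measure (X × Y)) (lam : ℝ) (f : H) : Prop :=
  ∀ g : H, regRiskStar L P lam f ≤ regRiskStar L P lam g

/-- The regularized empirical risk
`(1 / n) * ∑ i, l (x i, y i, f (x i)) + lam * ‖f‖²` of `f`, for an arbitrary loss `l` and the
data set `D = ((x 1, y 1), …, (x n, y n))`. -/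
def empRegRisk (l : X → Y → ℝ → ℝ) {n : ℕ} (D : Fin n → X × Y) (lam : ℝ) (f : H) : ℝ :=
  (1 / (n : ℝ)) * ∑ i, l (D i).1 (D i).2 (f (D i).1) + lam * ‖f‖ ^ 2

/-- `f` is an empirical support vector machine for the loss `l` and the data `D`. -/
def IsEmpSVM (l : X → Y → ℝ → ℝ) {n : ℕ} (D : Fin n → X × Y) (lam : ℝ) (f : H) : Prop :=
  ∀ g : H, empRegRisk l D lam f ≤ empRegRisk l D lam g

end RKHS

/-- The random data set consisting of the first `n` observations. -/
def dataSet {Ω X Y : Type*} (x : ℕ → Ω → X) (y : ℕ → Ω → Y) (n : ℕ) (ω : Ω) : Fin n → X × Y :=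
  fun i => (x i ω, y i ω)

end SVM

end

/-! With `K = C * √B`, where `B` bounds the kernel, the map `f ↦ L*(x, y, f x)` is convex,
`K`-Lipschitz on `H` and zero at the origin. The regularizer adds strong convexity, so minimizers
exist, are unique, and lie in the ball of radius `K / lam`, whatever the measure or the data. By
`IsRegMin.stability`, two minimizers are close once the unregularized functionals are uniformly
close on that ball.

Continuity of `L` and of the kernel makes `z ↦ ψ z`, restricted to the ball, a bounded continuous
map into a Banach space of functions. The strong law there gives uniform convergence on the ball,
hence (a); (b)–(d) follow by continuity. If an SVM for `L` exists, `L(x, y, 0)` is integrable, and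
the two risks differ by a finite constant. -/

namespace SVM

open scoped BoundedContinuousFunction

/-! ### Strongly convex minimization in a Hilbert space -/

section Minimizers

variable {H : Type*} [NormedAddCommGroup H] [InnerProductSpace ℝ H]

/-- A convex `K`-Lipschitz function on `H` that vanishes at the origin. -/
structure IsLipConvex (K : ℝ) (G : H → ℝ) : Prop where
  convex : ConvexOn ℝ Set.univ G
  zero : G 0 = 0
  lip : ∀ f g, |G f - G g| ≤ K * ‖f - g‖

/-- `f` minimizes `G + lam * ‖·‖²`. -/
def IsRegMin (G : H → ℝ) (lam : ℝ) (f : H) : Prop :=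
  ∀ g, G f + lam * ‖f‖ ^ 2 ≤ G g + lam * ‖g‖ ^ 2

theorem IsLipConvex.abs_le_norm {K : ℝ} {G : H → ℝ} (hG : IsLipConvex K G) (f : H) :
    |G f| ≤ K * ‖f‖ := by
  simpa [hG.zero] using hG.lip f 0

theorem IsLipConvex.continuous {K : ℝ} {G : H → ℝ} (hG : IsLipConvex K G) : Continuous G :=
  (LipschitzWith.of_dist_le' (K := K) fun f g => by
    simpa [Real.dist_eq, dist_eq_norm] using hG.lip f g).continuous

/-- The parallelogram law turns the squared norm into a quadratic surplus at midpoints. Both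
existence and stability of minimizers rest on it. -/
theorem IsLipConvex.midpoint_le {K : ℝ} {G : H → ℝ} (hG : IsLipConvex K G) (lam : ℝ) (f g : H) :
    G ((1 / 2 : ℝ) • (f + g)) + lam * ‖(1 / 2 : ℝ) • (f + g)‖ ^ 2 + lam / 4 * ‖f - g‖ ^ 2 ≤
      ((G f + lam * ‖f‖ ^ 2) + (G g + lam * ‖g‖ ^ 2)) / 2 := by
  have h1 := hG.convex.2 (Set.mem_univ f) (Set.mem_univ g) (show (0 : ℝ) ≤ 1 / 2 by norm_num)
    (show (0 : ℝ) ≤ 1 / 2 by norm_num) (by norm_num)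
  rw [← smul_add] at h1
  have h2 := parallelogram_law_with_norm ℝ f g
  have h3 : ‖(1 / 2 : ℝ) • (f + g)‖ ^ 2 = 1 / 4 * ‖f + g‖ ^ 2 := by
    rw [norm_smul, mul_pow]; norm_num
  simp only [smul_eq_mul] at h1
  rw [h3]
  linear_combination h1 + lam / 4 * h2

/-- A minimizer of a strongly convex function beats any competitor by a quadratic margin. -/
theorem IsRegMin.gap {K lam : ℝ} {G : H → ℝ} (hG : IsLipConvex K G) {f : H}
    (hf : IsRegMin G lam f) (g : H) :
    G f + lam * ‖f‖ ^ 2 + lam / 2 * ‖f - g‖ ^ 2 ≤ G g + lam * ‖g‖ ^ 2 := by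
  have h1 := hG.midpoint_le lam f g
  have h2 := hf ((1 / 2 : ℝ) • (f + g))
  linarith

/-- Comparison with `0` gives `lam * ‖f‖ ^ 2 ≤ -G f ≤ K * ‖f‖`. The radius depends on `G` only
through `K`, so one ball serves all samples. -/
theorem IsRegMin.norm_le {K lam : ℝ} (hlam : 0 < lam) {G : H → ℝ} (hG : IsLipConvex K G) {f : H}
    (hf : IsRegMin G lam f) (hK : 0 ≤ K) : ‖f‖ ≤ K / lam := by
  have h1 := hf 0
  have h2 := (abs_le.1 (hG.abs_le_norm f)).1
  simp only [hG.zero, norm_zero] at h1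
  rw [le_div_iff₀ hlam]
  rcases eq_or_lt_of_le (norm_nonneg f) with h | h
  · rw [← h]; linarith
  · refine le_of_mul_le_mul_right ?_ h
    linarith

theorem IsRegMin.eq {K lam : ℝ} (hlam : 0 < lam) {G : H → ℝ} (hG : IsLipConvex K G) {f g : H}
    (hf : IsRegMin G lam f) (hg : IsRegMin G lam g) : g = f := by
  have h1 := hf.gap hG g
  have h2 := hg f
  have h3 : lam / 2 * ‖f - g‖ ^ 2 ≤ 0 := by linarith
  have h4 : ‖f - g‖ ^ 2 ≤ 0 := nonpos_of_mul_nonpos_right h3 (by linarith)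
  have h5 : ‖f - g‖ = 0 := by simpa using le_antisymm h4 (sq_nonneg _)
  exact (sub_eq_zero.1 (norm_eq_zero.1 h5)).symm

/-- Minimizers of regularized functions depend continuously on the function, in the topology of
uniform convergence on a ball. -/
theorem IsRegMin.stability {K lam : ℝ} {G G' : H → ℝ} (hG : IsLipConvex K G)
    (hG' : IsLipConvex K G') {f g : H} (hf : IsRegMin G lam f) (hg : IsRegMin G' lam g) {δ : ℝ}
    (h1 : |G f - G' f| ≤ δ) (h2 : |G g - G' g| ≤ δ) : lam * ‖f - g‖ ^ 2 ≤ 2 * δ := by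
  -- Adding the two gaps cancels the regularizers and leaves only differences `G - G'` at `f` and
  -- `g`.
  have h3 := hf.gap hG g
  have h4 := hg.gap hG' f
  rw [norm_sub_rev g f] at h4
  have h5 := (abs_le.1 h1).1
  have h6 := (abs_le.1 h2).2
  linarith

theorem IsLipConvex.exists_isRegMin [CompleteSpace H] {K lam : ℝ} (hlam : 0 < lam) {G : H → ℝ}
    (hG : IsLipConvex K G) : ∃ f, IsRegMin G lam f := by
  set F : H → ℝ := fun f => G f + lam * ‖f‖ ^ 2 with hF
  have hFc : Continuous F := by
    have := hG.continuous
    fun_prop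
  have hbdd : BddBelow (Set.range F) := by
    -- The minimum over `t` of `lam * t ^ 2 - K * t`.
    refine ⟨-(K ^ 2 / (4 * lam)), ?_⟩
    rintro _ ⟨f, rfl⟩
    have h1 := (abs_le.1 (hG.abs_le_norm f)).1
    have h2 : K ^ 2 / (4 * lam) - K * ‖f‖ + lam * ‖f‖ ^ 2 =
        (K - 2 * lam * ‖f‖) ^ 2 / (4 * lam) := by field_simp; ring
    have h3 : 0 ≤ (K - 2 * lam * ‖f‖) ^ 2 / (4 * lam) := by positivity
    simp only [hF]
    linarith
  set m := ⨅ f, F f with hm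
  have hle : ∀ f, m ≤ F f := fun f => ciInf_le hbdd f
  have hex : ∀ n : ℕ, ∃ f, F f < m + 1 / ((n : ℝ) + 1) := fun n =>
    exists_lt_of_ciInf_lt (by have : (0 : ℝ) < 1 / ((n : ℝ) + 1) := by positivity
                              linarith)
  choose a ha using hex
  have ht : Tendsto (fun n : ℕ => 1 / ((n : ℝ) + 1)) atTop (𝓝 0) :=
    tendsto_one_div_add_atTop_nhds_zero_nat
  have hcau : CauchySeq a := by
    refine cauchySeq_of_le_tendsto_0 (fun N : ℕ => √(4 / lam * (1 / ((N : ℝ) + 1)))) ?_ ?_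
    · intro n k N hn hk
      rw [dist_eq_norm]
      refine Real.le_sqrt_of_sq_le ?_
      have h1 := hG.midpoint_le lam (a n) (a k)
      have h2 := hle ((1 / 2 : ℝ) • (a n + a k))
      have h3 := ha n
      have h4 := ha k
      have h5 : 1 / ((n : ℝ) + 1) ≤ 1 / ((N : ℝ) + 1) := Nat.one_div_le_one_div hn
      have h6 : 1 / ((k : ℝ) + 1) ≤ 1 / ((N : ℝ) + 1) := Nat.one_div_le_one_div hk
      simp only [hF] at h2 h3 h4
      have h7 : lam / 4 * ‖a n - a k‖ ^ 2 ≤ 1 / ((N : ℝ) + 1) := by linarith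
      calc ‖a n - a k‖ ^ 2 = 4 / lam * (lam / 4 * ‖a n - a k‖ ^ 2) := by field_simp
        _ ≤ _ := by gcongr
    · simpa using (ht.const_mul (4 / lam)).sqrt
  obtain ⟨f, hf⟩ := cauchySeq_tendsto_of_complete hcau
  refine ⟨f, fun g => ?_⟩
  have h1 : F f ≤ m := by
    refine le_of_tendsto_of_tendsto ((hFc.tendsto f).comp hf) (add_zero m ▸ ht.const_add m) ?_
    exact Eventually.of_forall fun n => (ha n).le
  exact h1.trans (hle g)

end Minimizers

/-! ### Empirical means, expectations and the strong law -/

section Integrands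

variable {Z H : Type*} [TopologicalSpace Z] [NormedAddCommGroup H] [InnerProductSpace ℝ H]

/-- A function of `z` and `f` that is convex and Lipschitz in `f` and continuous in `z`, locally
uniformly in `f`. -/
structure IsLipConvexIntegrand (K : ℝ) (ψ : Z → H → ℝ) : Prop where
  nonneg : 0 ≤ K
  lipConvex : ∀ z, IsLipConvex K (ψ z)
  continuous_unif : ∀ R z₀, ∀ ε > 0, ∀ᶠ z in 𝓝 z₀, ∀ f : H, ‖f‖ ≤ R → |ψ z f - ψ z₀ f| ≤ ε

/-- The average of `ψ` over the data `D`. -/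
noncomputable def empMean (ψ : Z → H → ℝ) {n : ℕ} (D : Fin n → Z) (f : H) : ℝ :=
  (1 / (n : ℝ)) * ∑ i, ψ (D i) f

namespace IsLipConvexIntegrand

variable {K : ℝ} {ψ : Z → H → ℝ} (hψ : IsLipConvexIntegrand K ψ)
include hψ

theorem continuous_left (f : H) : Continuous fun z => ψ z f := by
  refine continuous_iff_continuousAt.2 fun z₀ => Metric.tendsto_nhds.2 fun ε hε => ?_
  filter_upwards [hψ.continuous_unif ‖f‖ z₀ (ε / 2) (half_pos hε)] with z hz
  rw [Real.dist_eq]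
  linarith [hz f le_rfl]

theorem empMean {n : ℕ} (D : Fin n → Z) : IsLipConvex K (empMean ψ D) where
  convex := by
    refine ⟨convex_univ, fun f _ g _ a b ha hb hab => ?_⟩
    have h : ∑ i, ψ (D i) (a • f + b • g) ≤ ∑ i, (a * ψ (D i) f + b * ψ (D i) g) :=
      Finset.sum_le_sum fun i _ => by
        simpa using (hψ.lipConvex (D i)).convex.2 (Set.mem_univ f) (Set.mem_univ g) ha hb hab
    rw [Finset.sum_add_distrib, ← Finset.mul_sum, ← Finset.mul_sum] at h
    have h' := mul_le_mul_of_nonneg_left h (show (0 : ℝ) ≤ 1 / n by positivity)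
    simp only [SVM.empMean, smul_eq_mul]
    linarith
  zero := by simp [SVM.empMean, (hψ.lipConvex _).zero]
  lip f g := by
    -- For `n = 0` the mean is identically zero, and only `0 ≤ K` is needed.
    rcases Nat.eq_zero_or_pos n with rfl | hn
    · have := hψ.nonneg
      simp only [SVM.empMean, Finset.univ_eq_empty, Finset.sum_empty, mul_zero, sub_zero, abs_zero]
      positivity
    · have hn' : (0 : ℝ) < n := by exact_mod_cast hn
      rw [SVM.empMean, SVM.empMean, ← mul_sub, ← Finset.sum_sub_distrib, abs_mul,
        abs_of_nonneg (by positivity : (0 : ℝ) ≤ 1 / n)]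
      calc 1 / (n : ℝ) * |∑ i, (ψ (D i) f - ψ (D i) g)|
          ≤ 1 / (n : ℝ) * ∑ i : Fin n, K * ‖f - g‖ := by
            gcongr
            exact (Finset.abs_sum_le_sum_abs _ _).trans
              (Finset.sum_le_sum fun i _ => (hψ.lipConvex _).lip f g)
        _ = K * ‖f - g‖ := by
            simp only [Finset.sum_const, Finset.card_univ, Fintype.card_fin, nsmul_eq_mul]
            field_simp

/-- The restriction of `ψ z` to a ball, as a bounded continuous function. -/
noncomputable def onBall (R : ℝ) (z : Z) : Metric.closedBall (0 : H) R →ᵇ ℝ :=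
  BoundedContinuousFunction.ofNormedAddCommGroup (fun f => ψ z f)
    ((hψ.lipConvex z).continuous.comp continuous_subtype_val) (K * R) fun f => by
      have hf : ‖(f : H)‖ ≤ R := mem_closedBall_zero_iff.1 f.2
      exact ((hψ.lipConvex z).abs_le_norm f).trans (mul_le_mul_of_nonneg_left hf hψ.nonneg)

theorem onBall_apply (R : ℝ) (z : Z) (f : Metric.closedBall (0 : H) R) :
    hψ.onBall R z f = ψ z f := rfl

theorem norm_onBall_le {R : ℝ} (hR : 0 ≤ R) (z : Z) : ‖hψ.onBall R z‖ ≤ K * R :=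
  BoundedContinuousFunction.norm_ofNormedAddCommGroup_le _ (mul_nonneg hψ.nonneg hR) _

/-- The field `continuous_unif` is continuity in the sup norm over a ball; this makes the integrand
along the sample a Banach-space-valued random variable. -/
theorem continuous_onBall (R : ℝ) : Continuous (hψ.onBall R) := by
  refine continuous_iff_continuousAt.2 fun z₀ => Metric.tendsto_nhds.2 fun ε hε => ?_
  filter_upwards [hψ.continuous_unif R z₀ (ε / 2) (half_pos hε)] with z hz
  refine ((BoundedContinuousFunction.dist_le (half_pos hε).le).2 fun f => ?_).trans_lt
    (half_lt_self hε)
  exact hz f (mem_closedBall_zero_iff.1 f.2)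

theorem empMean_eq_onBall {n : ℕ} (D : Fin n → Z) (R : ℝ) (f : Metric.closedBall (0 : H) R) :
    SVM.empMean ψ D f = ((1 / (n : ℝ)) • ∑ i, hψ.onBall R (D i)) f := by
  simp [SVM.empMean, hψ.onBall_apply]

/-- The minimizer of the regularized empirical mean depends continuously on the data. -/
theorem continuous_of_isRegMin {lam : ℝ} (hlam : 0 < lam) {n : ℕ} {M : (Fin n → Z) → H}
    (hM : ∀ D, IsRegMin (SVM.empMean ψ D) lam (M D)) : Continuous M := by
  set R := K / lam
  have hR : ∀ D, M D ∈ Metric.closedBall (0 : H) R := fun D => by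
    simpa using (hM D).norm_le hlam (hψ.empMean D) hψ.nonneg
  let A : (Fin n → Z) → (Metric.closedBall (0 : H) R →ᵇ ℝ) :=
    fun D => (1 / (n : ℝ)) • ∑ i, hψ.onBall R (D i)
  have hA : Continuous A := by
    have := hψ.continuous_onBall R
    fun_prop
  -- Stability makes the minimizer 1/2-Hölder in the averaged integrand.
  have key : ∀ D D', ‖M D - M D'‖ ≤ √(2 / lam * ‖A D - A D'‖) := fun D D' => by
    refine Real.le_sqrt_of_sq_le ?_
    have h : ∀ f (hf : f ∈ Metric.closedBall (0 : H) R),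
        |SVM.empMean ψ D f - SVM.empMean ψ D' f| ≤ ‖A D - A D'‖ := fun f hf => by
      rw [hψ.empMean_eq_onBall D R ⟨f, hf⟩, hψ.empMean_eq_onBall D' R ⟨f, hf⟩]
      exact (A D - A D').norm_coe_le_norm ⟨f, hf⟩
    have h1 := (hM D).stability (hψ.empMean D) (hψ.empMean D') (hM D') (h _ (hR D)) (h _ (hR D'))
    calc ‖M D - M D'‖ ^ 2 = 1 / lam * (lam * ‖M D - M D'‖ ^ 2) := by field_simp
      _ ≤ 1 / lam * (2 * ‖A D - A D'‖) := by gcongr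
      _ = _ := by ring
  refine continuous_iff_continuousAt.2 fun D => tendsto_iff_norm_sub_tendsto_zero.2 ?_
  refine squeeze_zero (fun _ => norm_nonneg _) (fun D' => key D' D) ?_
  have h2 : Continuous fun D' => √(2 / lam * ‖A D' - A D‖) := by fun_prop
  simpa using h2.tendsto D

section Integral

variable [MeasurableSpace Z] [BorelSpace Z] [SecondCountableTopology Z]

omit [SecondCountableTopology Z] in
theorem integrable (P : Measure Z) [IsFiniteMeasure P] (f : H) :
    Integrable (fun z => ψ z f) P :=
  Integrable.of_bound (hψ.continuous_left f).measurable.aestronglyMeasurable (K * ‖f‖)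
    (ae_of_all _ fun z => (hψ.lipConvex z).abs_le_norm f)

omit [SecondCountableTopology Z] in
theorem integral (P : Measure Z) [IsProbabilityMeasure P] :
    IsLipConvex K fun f => ∫ z, ψ z f ∂P where
  convex := by
    refine ⟨convex_univ, fun f _ g _ a b ha hb hab => ?_⟩
    have hf := hψ.integrable P f
    have hg := hψ.integrable P g
    simp only [smul_eq_mul]
    rw [← integral_const_mul, ← integral_const_mul,
      ← integral_add (hf.const_mul a) (hg.const_mul b)]
    exact integral_mono (hψ.integrable P _) ((hf.const_mul a).add (hg.const_mul b)) fun z => by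
      simpa using (hψ.lipConvex z).convex.2 (Set.mem_univ f) (Set.mem_univ g) ha hb hab
  zero := by simp [(hψ.lipConvex _).zero]
  lip f g := by
    rw [← integral_sub (hψ.integrable P f) (hψ.integrable P g)]
    have h := norm_integral_le_of_norm_le_const (μ := P)
      (f := fun z => ψ z f - ψ z g) (C := K * ‖f - g‖)
      (ae_of_all _ fun z => (hψ.lipConvex z).lip f g)
    simpa using h

/-- Minimizers of regularized empirical means are strongly measurable functions of the sample. -/
theorem stronglyMeasurable_of_isRegMin [TopologicalSpace.PseudoMetrizableSpace Z] {Ω : Type*} [MeasurableSpace Ω]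
    [CompleteSpace H] {lam : ℝ} (hlam : 0 < lam) {n : ℕ} {D : Ω → Fin n → Z} (hD : Measurable D)
    {fD : Ω → H} (hfD : ∀ ω, IsRegMin (SVM.empMean ψ (D ω)) lam (fD ω)) :
    StronglyMeasurable fD := by
  choose M hM using fun D : Fin n → Z => (hψ.empMean D).exists_isRegMin hlam
  have h : fD = M ∘ D := funext fun ω => (hM _).eq hlam (hψ.empMean _) (hfD ω)
  rw [h]
  exact (hψ.continuous_of_isRegMin hlam hM).stronglyMeasurable.comp_measurable hD

/-- Minimizers of regularized empirical means of an i.i.d. sample converge almost surely to the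
minimizer of the regularized expectation. -/
theorem tendsto_of_isRegMin [TopologicalSpace.PseudoMetrizableSpace Z]
    {Ω : Type*} [MeasurableSpace Ω] (Q : Measure Ω) [IsProbabilityMeasure Q]
    (P : Measure Z) [IsProbabilityMeasure P] {ξ : ℕ → Ω → Z} (hξ : ∀ i, Measurable (ξ i))
    (h_indep : iIndepFun ξ Q) (h_law : ∀ i, Measure.map (ξ i) Q = P)
    {lam : ℝ} (hlam : 0 < lam) {fP : H} (hfP : IsRegMin (fun f => ∫ z, ψ z f ∂P) lam fP)
    {fD : ℕ → Ω → H}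
    (hfD : ∀ n ω, IsRegMin (SVM.empMean ψ fun i : Fin n => ξ i ω) lam (fD n ω)) :
    ∀ᵐ ω ∂Q, Tendsto (fun n => fD n ω) atTop (𝓝 fP) := by
  set R := K / lam
  have hR0 : 0 ≤ R := div_nonneg hψ.nonneg hlam.le
  let E := Metric.closedBall (0 : H) R →ᵇ ℝ
  borelize E
  have hc := hψ.continuous_onBall R
  -- `E` need not be separable; second countability of `Z` supplies strong measurability.
  have hsm : StronglyMeasurable (hψ.onBall R) := hc.stronglyMeasurable
  have hint : ∀ i, Integrable (hψ.onBall R ∘ ξ i) Q := fun i =>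
    Integrable.of_bound (hsm.comp_measurable (hξ i)).aestronglyMeasurable (K * R)
      (ae_of_all _ fun ω => hψ.norm_onBall_le hR0 _)
  have hslln := strong_law_ae (μ := Q) (fun i => hψ.onBall R ∘ ξ i) (hint 0)
    (fun i j hij => (h_indep.indepFun hij).comp hc.measurable hc.measurable)
    (fun i => (IdentDistrib.mk (hξ i).aemeasurable (hξ 0).aemeasurable
      (by rw [h_law, h_law])).comp hc.measurable)
  have hmean : ∀ f : Metric.closedBall (0 : H) R,
      (∫ ω, (hψ.onBall R ∘ ξ 0) ω ∂Q) f = ∫ z, ψ z f ∂P := fun f => by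
    -- Evaluation is continuous and linear, so it commutes with the Bochner integral.
    have h1 := (BoundedContinuousFunction.evalCLM ℝ f).integral_comp_comm (hint 0)
    rw [← h_law 0, integral_map (hξ 0).aemeasurable
      (hψ.continuous_left (f : H)).measurable.aestronglyMeasurable]
    exact h1.symm
  filter_upwards [hslln] with ω hω
  rw [tendsto_iff_norm_sub_tendsto_zero] at hω ⊢
  have hG := hψ.integral P
  have h2 := ((hω.const_mul (2 / lam))).sqrt
  rw [mul_zero, Real.sqrt_zero] at h2
  refine squeeze_zero (fun _ => norm_nonneg _) (fun n => ?_) h2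
  refine Real.le_sqrt_of_sq_le ?_
  set A : E := (n : ℝ)⁻¹ • ∑ i ∈ Finset.range n, (hψ.onBall R ∘ ξ i) ω with hA
  set B : E := ∫ ω, (hψ.onBall R ∘ ξ 0) ω ∂Q
  have hdiff : ∀ f ∈ Metric.closedBall (0 : H) R,
      |SVM.empMean ψ (fun i : Fin n => ξ i ω) f - ∫ z, ψ z f ∂P| ≤ ‖A - B‖ := fun f hf => by
    have hAf : A ⟨f, hf⟩ = SVM.empMean ψ (fun i : Fin n => ξ i ω) f := by
      rw [hψ.empMean_eq_onBall _ R ⟨f, hf⟩, hA, Finset.sum_range, one_div]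
      rfl
    rw [← hAf, ← hmean ⟨f, hf⟩]
    exact (A - B).norm_coe_le_norm ⟨f, hf⟩
  have hE := hψ.empMean fun i : Fin n => ξ i ω
  have h3 := (hfD n ω).stability hE hG hfP
    (hdiff _ (by simpa using (hfD n ω).norm_le hlam hE hψ.nonneg))
    (hdiff _ (by simpa using hfP.norm_le hlam hG hψ.nonneg))
  calc ‖fD n ω - fP‖ ^ 2 = 1 / lam * (lam * ‖fD n ω - fP‖ ^ 2) := by field_simp
    _ ≤ 1 / lam * (2 * ‖A - B‖) := by gcongr
    _ = _ := by ring

end Integral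

end IsLipConvexIntegrand

end Integrands

end SVM
namespace SVM

/-! ### The RKHS and the shifted loss -/

section Kernel

variable {X H : Type*} [NormedAddCommGroup H] [InnerProductSpace ℝ H] [CompleteSpace H]
  [RKHS ℝ H X ℝ]

theorem apply_eq_inner_kerFun (f : H) (u : X) : f u = inner ℝ f (RKHS.kerFun H u 1) := by
  simp

theorem inner_kerFun_kerFun (u v : X) :
    inner ℝ (RKHS.kerFun H u 1) (RKHS.kerFun H v 1) = RKHS.kernel H u v 1 := by
  rw [← RKHS.kerFun_apply, real_inner_comm, ← apply_eq_inner_kerFun]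

theorem norm_kerFun_one_le {B : ℝ} (hB : ∀ u v : X, |RKHS.kernel H u v 1| ≤ B) (u : X) :
    ‖RKHS.kerFun H u 1‖ ≤ √B := by
  refine Real.le_sqrt_of_sq_le ?_
  rw [← real_inner_self_eq_norm_sq, inner_kerFun_kerFun]
  exact (le_abs_self _).trans (hB u u)

theorem abs_apply_le {B : ℝ} (hB : ∀ u v : X, |RKHS.kernel H u v 1| ≤ B) (f : H) (u : X) :
    |f u| ≤ √B * ‖f‖ := by
  rw [apply_eq_inner_kerFun, mul_comm]
  exact (abs_real_inner_le_norm _ _).trans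
    (mul_le_mul_of_nonneg_left (norm_kerFun_one_le hB u) (norm_nonneg _))

theorem abs_apply_sub_apply_le (f : H) (u v : X) :
    |f u - f v| ≤ ‖f‖ * ‖RKHS.kerFun H u 1 - RKHS.kerFun H v 1‖ := by
  rw [apply_eq_inner_kerFun, apply_eq_inner_kerFun, ← inner_sub_right]
  exact abs_real_inner_le_norm _ _

/-- Expanding the squared distance of two kernel sections leaves only kernel values. -/
theorem continuous_kerFun_one [TopologicalSpace X]
    (hk : Continuous fun p : X × X => RKHS.kernel H p.1 p.2 1) :
    Continuous fun u : X => RKHS.kerFun H u 1 := by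
  refine continuous_iff_continuousAt.2 fun v => tendsto_iff_norm_sub_tendsto_zero.2 ?_
  have h : ∀ u, ‖RKHS.kerFun H u 1 - RKHS.kerFun H v 1‖ =
      √(RKHS.kernel H u u 1 - 2 * RKHS.kernel H u v 1 + RKHS.kernel H v v 1) := fun u => by
    have h0 : ∀ a b : H, ‖a - b‖ = √(inner ℝ a a - 2 * inner ℝ a b + inner ℝ b b) := fun a b => by
      rw [real_inner_self_eq_norm_sq, real_inner_self_eq_norm_sq, ← norm_sub_sq_real,
        Real.sqrt_sq (norm_nonneg _)]
    simp only [h0, inner_kerFun_kerFun]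
  simp_rw [h]
  have h1 : Continuous fun u => RKHS.kernel H u u 1 :=
    hk.comp
      (g := fun p : X × X => RKHS.kernel H p.1 p.2 1) (f := fun u => (u, u)) (by fun_prop)
  have h2 : Continuous fun u => RKHS.kernel H u v 1 :=
    hk.comp
      (g := fun p : X × X => RKHS.kernel H p.1 p.2 1) (f := fun u => (u, v)) (by fun_prop)
  have h3 : Continuous fun u =>
      √(RKHS.kernel H u u 1 - 2 * RKHS.kernel H u v 1 + RKHS.kernel H v v 1) := by fun_prop
  have h4 := h3.tendsto v
  rwa [show RKHS.kernel H v v 1 - 2 * RKHS.kernel H v v 1 + RKHS.kernel H v v 1 = 0 by ring,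
    Real.sqrt_zero] at h4

theorem continuous_coe_of_continuous_kernel [TopologicalSpace X]
    (hk : Continuous fun p : X × X => RKHS.kernel H p.1 p.2 1) (f : H) : Continuous f := by
  have h : (f : X → ℝ) = fun u => inner ℝ f (RKHS.kerFun H u 1) :=
    funext (apply_eq_inner_kerFun f)
  rw [h]
  exact continuous_const.inner (continuous_kerFun_one hk)

theorem tendsto_iSup_ofReal_abs_apply_sub {B : ℝ} (hB : ∀ u v : X, |RKHS.kernel H u v 1| ≤ B)
    {ι : Type*} {l : Filter ι} {F : ι → H} {f : H} (hF : Tendsto (fun i => ‖F i - f‖) l (𝓝 0)) :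
    Tendsto (fun i => ⨆ u : X, ENNReal.ofReal |F i u - f u|) l (𝓝 0) := by
  have h := ENNReal.tendsto_ofReal (hF.const_mul √B)
  rw [mul_zero, ENNReal.ofReal_zero] at h
  refine tendsto_of_tendsto_of_tendsto_of_le_of_le tendsto_const_nhds h (fun _ => zero_le) fun i =>
    iSup_le fun u => ENNReal.ofReal_le_ofReal ?_
  have := abs_apply_le hB (F i - f) u
  rwa [RKHS.coe_sub] at this

/-- The shifted loss, evaluated along an element of the RKHS. -/
noncomputable def shiftedIntegrand {Y : Type*} (L : X → Y → ℝ → ℝ) : X × Y → H → ℝ :=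
  fun z f => shiftedLoss L z.1 z.2 (f z.1)

theorem isLipConvexIntegrand_shiftedIntegrand {Y : Type*} [TopologicalSpace X] [TopologicalSpace Y]
    {L : X → Y → ℝ → ℝ} (hL_cont : Continuous fun p : X × Y × ℝ => L p.1 p.2.1 p.2.2)
    (hL_convex : ∀ x y, ConvexOn ℝ Set.univ (L x y)) {C : ℝ} (hC : 0 ≤ C)
    (hL_lip : ∀ x y t t', |L x y t - L x y t'| ≤ C * |t - t'|)
    (hk : Continuous fun p : X × X => RKHS.kernel H p.1 p.2 1)
    {B : ℝ} (hB : ∀ u v : X, |RKHS.kernel H u v 1| ≤ B) :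
    IsLipConvexIntegrand (C * √B) (shiftedIntegrand (H := H) L) where
  nonneg := by positivity
  lipConvex z :=
    { convex := by
        refine ⟨convex_univ, fun f _ g _ a b ha hb hab => ?_⟩
        have h := (hL_convex z.1 z.2).2 (Set.mem_univ (f z.1)) (Set.mem_univ (g z.1)) ha hb hab
        simp only [shiftedIntegrand, shiftedLoss, RKHS.coe_add, RKHS.coe_smul, Pi.add_apply,
          Pi.smul_apply, smul_eq_mul] at h ⊢
        linear_combination h + L z.1 z.2 0 * hab
      zero := by simp [shiftedIntegrand, shiftedLoss]
      lip f g := by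
        simp only [shiftedIntegrand, shiftedLoss, sub_sub_sub_cancel_right]
        have h := abs_apply_le hB (f - g) z.1
        rw [RKHS.coe_sub, Pi.sub_apply] at h
        rw [mul_assoc]
        exact (hL_lip _ _ _ _).trans (mul_le_mul_of_nonneg_left h hC) }
  continuous_unif R z₀ ε hε := by
    have hcont : Continuous (Function.uncurry fun (z : X × Y) (t : ℝ) => shiftedLoss L z.1 z.2 t) := by
      have h1 : Continuous fun p : (X × Y) × ℝ => L p.1.1 p.1.2 p.2 :=
        hL_cont.comp (g := fun p : X × Y × ℝ => L p.1 p.2.1 p.2.2)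
          (f := fun p : (X × Y) × ℝ => (p.1.1, p.1.2, p.2)) (by fun_prop)
      have h2 : Continuous fun p : (X × Y) × ℝ => L p.1.1 p.1.2 0 :=
        hL_cont.comp (g := fun p : X × Y × ℝ => L p.1 p.2.1 p.2.2)
          (f := fun p : (X × Y) × ℝ => (p.1.1, p.1.2, 0)) (by fun_prop)
      exact h1.sub h2
    -- All values of `f` with `‖f‖ ≤ R` lie in this compact interval, on which the loss is
    -- continuous in `z` uniformly in `t`.
    obtain ⟨v, hv, hvu⟩ := (isCompact_closedBall (0 : ℝ) (√B * R)).mem_uniformity_of_prod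
      (s := Set.univ) (q := z₀) hcont.continuousOn (Set.mem_univ _)
      (Metric.dist_mem_uniformity (half_pos hε))
    rw [nhdsWithin_univ] at hv
    have hΦ : Tendsto (fun z : X × Y =>
        C * (R * ‖RKHS.kerFun H z.1 1 - RKHS.kerFun H z₀.1 1‖)) (𝓝 z₀) (𝓝 0) := by
      have h1 : Continuous fun z : X × Y => RKHS.kerFun H z.1 1 :=
        (continuous_kerFun_one hk).comp continuous_fst
      have h2 : Continuous fun z : X × Y =>
        C * (R * ‖RKHS.kerFun H z.1 1 - RKHS.kerFun H z₀.1 1‖) := by fun_prop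
      simpa using h2.tendsto z₀
    filter_upwards [hv, hΦ.eventually_lt_const (half_pos hε)] with z hz1 hz2 f hf
    have h1 : |L z.1 z.2 (f z.1) - L z.1 z.2 (f z₀.1)| ≤ ε / 2 := by
      refine ((hL_lip _ _ _ _).trans (mul_le_mul_of_nonneg_left ?_ hC)).trans hz2.le
      exact (abs_apply_sub_apply_le f _ _).trans
        (mul_le_mul_of_nonneg_right hf (norm_nonneg _))
    have h2 := hvu z hz1 (f z₀.1) (by
      rw [mem_closedBall_zero_iff, Real.norm_eq_abs]
      exact (abs_apply_le hB f _).trans (mul_le_mul_of_nonneg_left hf (Real.sqrt_nonneg _)))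
    simp only [Set.mem_ofPred_eq, Real.dist_eq] at h2
    simp only [shiftedIntegrand]
    -- Passing through `f z₀.1` separates the change of `f`, handled by the Lipschitz bound, from
    -- the change of `z` at a fixed real argument, handled by compactness.
    have h3 : shiftedLoss L z.1 z.2 (f z.1) - shiftedLoss L z₀.1 z₀.2 (f z₀.1) =
        (L z.1 z.2 (f z.1) - L z.1 z.2 (f z₀.1)) +
        (shiftedLoss L z.1 z.2 (f z₀.1) - shiftedLoss L z₀.1 z₀.2 (f z₀.1)) := by
      simp only [shiftedLoss]; ring
    rw [h3]
    exact (abs_add_le _ _).trans (by linarith)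

omit [CompleteSpace H] in
theorem isEmpSVM_shiftedLoss_iff {Y : Type*} (L : X → Y → ℝ → ℝ) {n : ℕ} (D : Fin n → X × Y)
    (lam : ℝ) (f : H) : IsEmpSVM (shiftedLoss L) D lam f ↔ IsEmpSVM L D lam f := by
  have h : ∀ g : H, empRegRisk L D lam g = empRegRisk (shiftedLoss L) D lam g +
      (1 / (n : ℝ)) * ∑ i, L (D i).1 (D i).2 0 := fun g => by
    simp only [empRegRisk, shiftedLoss, Finset.sum_sub_distrib]
    ring
  simp only [IsEmpSVM, h, add_le_add_iff_right]

/-! ### Comparing the risks for `L` and `L*` -/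

section Risk

variable {Y : Type*} [MeasurableSpace X] [MeasurableSpace Y] {L : X → Y → ℝ → ℝ}
  {P : Measure (X × Y)}

omit [NormedAddCommGroup H] [InnerProductSpace ℝ H] [CompleteSpace H] [RKHS ℝ H X ℝ] in
theorem risk_eq_ofReal (hL_nonneg : ∀ x y t, 0 ≤ L x y t) {f : X → ℝ}
    (hf : Integrable (fun z : X × Y => shiftedLoss L z.1 z.2 (f z.1)) P)
    (h0 : Integrable (fun z : X × Y => L z.1 z.2 0) P) :
    0 ≤ riskStar L P f + ∫ z, L z.1 z.2 0 ∂P ∧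
      risk L P f = ENNReal.ofReal (riskStar L P f + ∫ z, L z.1 z.2 0 ∂P) := by
  have h1 : (fun z : X × Y => L z.1 z.2 (f z.1)) =
      fun z => shiftedLoss L z.1 z.2 (f z.1) + L z.1 z.2 0 := by
    funext z; simp [shiftedLoss]
  have h2 : riskStar L P f + ∫ z, L z.1 z.2 0 ∂P = ∫ z, L z.1 z.2 (f z.1) ∂P := by
    rw [h1, integral_add hf h0, riskStar]
  rw [h2]
  exact ⟨integral_nonneg fun z => hL_nonneg _ _ _,
    (ofReal_integral_eq_lintegral_ofReal (h1 ▸ hf.add h0)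
      (ae_of_all _ fun z => hL_nonneg _ _ _)).symm⟩

omit [CompleteSpace H] in
theorem regRisk_eq_ofReal (hL_nonneg : ∀ x y t, 0 ≤ L x y t) {f : H}
    (hf : Integrable (fun z : X × Y => shiftedLoss L z.1 z.2 (f z.1)) P)
    (h0 : Integrable (fun z : X × Y => L z.1 z.2 0) P) {lam : ℝ} (hlam : 0 ≤ lam) :
    0 ≤ regRiskStar L P lam f + ∫ z, L z.1 z.2 0 ∂P ∧
      regRisk L P lam f = ENNReal.ofReal (regRiskStar L P lam f + ∫ z, L z.1 z.2 0 ∂P) := by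
  obtain ⟨h1, h2⟩ := risk_eq_ofReal hL_nonneg hf h0
  have h3 : 0 ≤ lam * ‖f‖ ^ 2 := by positivity
  rw [regRisk, h2, ← ENNReal.ofReal_add h1 h3, regRiskStar, add_right_comm]
  exact ⟨add_nonneg h1 h3, rfl⟩

omit [CompleteSpace H] in
theorem isSVM_iff_isSVMStar (hL_nonneg : ∀ x y t, 0 ≤ L x y t)
    (hint : ∀ f : H, Integrable (fun z : X × Y => shiftedLoss L z.1 z.2 (f z.1)) P)
    (h0 : Integrable (fun z : X × Y => L z.1 z.2 0) P) {lam : ℝ} (hlam : 0 ≤ lam) (f : H) :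
    IsSVM L P lam f ↔ IsSVMStar L P lam f := by
  have h := fun g : H => regRisk_eq_ofReal hL_nonneg (hint g) h0 hlam
  have h' : ∀ g : H, regRisk L P lam f ≤ regRisk L P lam g ↔
      regRiskStar L P lam f ≤ regRiskStar L P lam g := fun g => by
    rw [(h f).2, (h g).2, ENNReal.ofReal_le_ofReal_iff (h g).1, add_le_add_iff_right]
  simp only [IsSVM, IsSVMStar, h', and_iff_right_iff_imp]
  intro _
  rw [(h f).2]
  exact ENNReal.ofReal_ne_top

omit [NormedAddCommGroup H] [InnerProductSpace ℝ H] [CompleteSpace H] [RKHS ℝ H X ℝ] in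
-- `L(x, y, 0)` is the difference of the integrable functions `L(x, y, f x)` and `L*(x, y, f x)`, so
-- finite risk at a single `f` suffices.
theorem integrable_loss_zero_of_risk_ne_top (hL_nonneg : ∀ x y t, 0 ≤ L x y t) {f : X → ℝ}
    (hmeas : AEStronglyMeasurable (fun z : X × Y => L z.1 z.2 0) P)
    (hf : Integrable (fun z : X × Y => shiftedLoss L z.1 z.2 (f z.1)) P)
    (hrisk : risk L P f ≠ ∞) : Integrable (fun z : X × Y => L z.1 z.2 0) P := by
  have h1 : (fun z : X × Y => L z.1 z.2 (f z.1)) =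
      (fun z => shiftedLoss L z.1 z.2 (f z.1)) + fun z => L z.1 z.2 0 := by
    funext z; simp [shiftedLoss]
  have h2 : Integrable (fun z : X × Y => L z.1 z.2 (f z.1)) P := by
    refine (lintegral_ofReal_ne_top_iff_integrable ?_ (ae_of_all _ fun z => hL_nonneg _ _ _)).1 hrisk
    rw [h1]
    exact hf.aestronglyMeasurable.add hmeas
  refine (h2.sub hf).congr (ae_of_all _ fun z => ?_)
  simp [shiftedLoss]

end Risk

end Kernel

end SVM


/-! ### The consistency theorem -/

theorem corollary3p5
    {Ω : Type*} [MeasurableSpace Ω] (Q : Measure Ω) [IsProbabilityMeasure Q]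
    {X : Type*} [TopologicalSpace X] [PolishSpace X] [MeasurableSpace X] [BorelSpace X]
    (Y : Set ℝ) (hY : IsClosed Y)
    -- the loss function
    (L : X → Y → ℝ → ℝ)
    (hL_nonneg : ∀ x y t, 0 ≤ L x y t)
    (hL_cont : Continuous fun p : X × Y × ℝ => L p.1 p.2.1 p.2.2)
    (hL_zero : ∀ x (y : Y), L x y (y : ℝ) = 0)
    (hL_convex : ∀ x y, ConvexOn ℝ Set.univ (L x y))
    (C : ℝ) (hC : 0 < C)
    (hL_lip : ∀ x y t t', |L x y t - L x y t'| ≤ C * |t - t'|)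
    -- the bounded continuous kernel `k` and its reproducing kernel Hilbert space `H`
    {H : Type*} [NormedAddCommGroup H] [InnerProductSpace ℝ H] [CompleteSpace H] [RKHS ℝ H X ℝ]
    (k : X → X → ℝ) (hk : ∀ x x', k x x' = RKHS.kernel H x x' 1)
    (hk_cont : Continuous fun p : X × X => k p.1 p.2)
    (hk_bdd : ∃ B : ℝ, ∀ x x', |k x x'| ≤ B)
    (lam : ℝ) (hlam : 0 < lam)
    -- the i.i.d. observations
    (P : Measure (X × Y)) [IsProbabilityMeasure P]
    (x : ℕ → Ω → X) (y : ℕ → Ω → Y)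
    (hx : ∀ i, Measurable (x i)) (hy : ∀ i, Measurable (y i))
    (h_indep : iIndepFun (fun i ω => (x i ω, y i ω)) Q)
    (h_law : ∀ i, Measure.map (fun ω => (x i ω, y i ω)) Q = P) :
    -- the `L*`-risks are well defined
    (∀ f : H, Integrable (fun z : X × Y => SVM.shiftedLoss L z.1 z.2 (f z.1)) P) ∧
    -- `fP` and `fD n ω` are the unique minimizers for `L*`
    (∃ (fP : H) (fD : ℕ → Ω → H),
      (∀ f : H, SVM.IsSVMStar L P lam f ↔ f = fP) ∧
      (∀ n, 0 < n → ∀ ω, ∀ f : H,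
        SVM.IsEmpSVM (SVM.shiftedLoss L) (SVM.dataSet x y n ω) lam f ↔ f = fD n ω) ∧
      (∀ n, 0 < n → StronglyMeasurable (fD n)) ∧
      (∀ᵐ ω ∂Q, Tendsto (fun n => ‖fD n ω - fP‖) atTop (𝓝 0)) ∧
      (∀ᵐ ω ∂Q, Tendsto (fun n => ⨆ u : X, ENNReal.ofReal |fD n ω u - fP u|) atTop (𝓝 0)) ∧
      (∀ᵐ ω ∂Q, Tendsto (fun n => SVM.regRiskStar L P lam (fD n ω)) atTop
        (𝓝 (SVM.regRiskStar L P lam fP))) ∧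
      (∀ᵐ ω ∂Q, Tendsto (fun n => SVM.riskStar L P (fD n ω)) atTop
        (𝓝 (SVM.riskStar L P fP)))) ∧
    -- the same for `L`, whenever a support vector machine for `L` and `P` exists
    ((∃ f : H, SVM.IsSVM L P lam f) →
      ∃ (gP : H) (gD : ℕ → Ω → H),
        (∀ f : H, SVM.IsSVM L P lam f ↔ f = gP) ∧
        (∀ n, 0 < n → ∀ ω, ∀ f : H,
          SVM.IsEmpSVM L (SVM.dataSet x y n ω) lam f ↔ f = gD n ω) ∧
        (∀ n, 0 < n → StronglyMeasurable (gD n)) ∧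
        (∀ᵐ ω ∂Q, Tendsto (fun n => ‖gD n ω - gP‖) atTop (𝓝 0)) ∧
        (∀ᵐ ω ∂Q, Tendsto (fun n => ⨆ u : X, ENNReal.ofReal |gD n ω u - gP u|) atTop (𝓝 0)) ∧
        (∀ᵐ ω ∂Q, Tendsto (fun n => SVM.regRisk L P lam (gD n ω)) atTop
          (𝓝 (SVM.regRisk L P lam gP))) ∧
        (∀ᵐ ω ∂Q, Tendsto (fun n => SVM.risk L P (gD n ω)) atTop
          (𝓝 (SVM.risk L P gP)))) := by
  obtain ⟨B, hB⟩ := hk_bdd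
  simp only [hk] at hB hk_cont
  have hψ : SVM.IsLipConvexIntegrand (C * √B) (SVM.shiftedIntegrand (H := H) L) :=
    SVM.isLipConvexIntegrand_shiftedIntegrand hL_cont hL_convex hC.le hL_lip hk_cont hB
  have hint : ∀ f : H, Integrable (fun z : X × Y => SVM.shiftedLoss L z.1 z.2 (f z.1)) P :=
    fun f => hψ.integrable P f
  have hG := hψ.integral P
  have hξ : ∀ i, Measurable fun ω => (x i ω, y i ω) := fun i => (hx i).prodMk (hy i)
  obtain ⟨fP, hfP⟩ := hG.exists_isRegMin hlam
  choose fD hfD using fun n ω =>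
    (hψ.empMean (SVM.dataSet x y n ω)).exists_isRegMin hlam
  have hfP_iff : ∀ f : H, SVM.IsSVMStar L P lam f ↔ f = fP := fun f =>
    -- `IsSVMStar` unfolds definitionally to `IsRegMin` for the expected shifted loss.
    ⟨fun hf => SVM.IsRegMin.eq hlam hG hfP hf, fun hf => hf ▸ hfP⟩
  have hfD_iff : ∀ n, 0 < n → ∀ ω, ∀ f : H,
      SVM.IsEmpSVM (SVM.shiftedLoss L) (SVM.dataSet x y n ω) lam f ↔ f = fD n ω :=
    fun n _ ω f => ⟨fun hf => SVM.IsRegMin.eq hlam (hψ.empMean _) (hfD n ω) hf,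
      fun hf => hf ▸ hfD n ω⟩
  have hmeas : ∀ n, 0 < n → StronglyMeasurable (fD n) := fun n _ =>
    hψ.stronglyMeasurable_of_isRegMin hlam (D := SVM.dataSet x y n)
      (measurable_pi_lambda _ fun i => hξ i) (hfD n)
  have hlim : ∀ᵐ ω ∂Q, Tendsto (fun n => fD n ω) atTop (𝓝 fP) :=
    hψ.tendsto_of_isRegMin Q P hξ h_indep h_law hlam hfP hfD
  have hnorm : ∀ᵐ ω ∂Q, Tendsto (fun n => ‖fD n ω - fP‖) atTop (𝓝 0) :=
    hlim.mono fun ω hω => tendsto_iff_norm_sub_tendsto_zero.1 hω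
  have hsup : ∀ᵐ ω ∂Q,
      Tendsto (fun n => ⨆ u : X, ENNReal.ofReal |fD n ω u - fP u|) atTop (𝓝 0) :=
    hnorm.mono fun ω hω => SVM.tendsto_iSup_ofReal_abs_apply_sub hB hω
  have hrisk_cont : Continuous fun f : H => SVM.riskStar L P f := hG.continuous
  have hreg_cont : Continuous fun f : H => SVM.regRiskStar L P lam f :=
    hrisk_cont.add (continuous_const.mul (continuous_norm.pow 2))
  have hreg : ∀ᵐ ω ∂Q, Tendsto (fun n => SVM.regRiskStar L P lam (fD n ω)) atTop
      (𝓝 (SVM.regRiskStar L P lam fP)) :=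
    hlim.mono fun ω hω => (hreg_cont.tendsto fP).comp hω
  have hrisk : ∀ᵐ ω ∂Q, Tendsto (fun n => SVM.riskStar L P (fD n ω)) atTop
      (𝓝 (SVM.riskStar L P fP)) :=
    hlim.mono fun ω hω => (hrisk_cont.tendsto fP).comp hω
  refine ⟨hint, ⟨fP, fD, hfP_iff, hfD_iff, hmeas, hnorm, hsup, hreg, hrisk⟩, ?_⟩
  rintro ⟨f, hf, -⟩
  have h0 : Integrable (fun z : X × Y => L z.1 z.2 0) P := by
    refine SVM.integrable_loss_zero_of_risk_ne_top hL_nonneg ?_ (hint f)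
      (ne_top_of_le_ne_top hf le_self_add)
    have h : Continuous fun z : X × Y => L z.1 z.2 0 :=
      hL_cont.comp (g := fun p : X × Y × ℝ => L p.1 p.2.1 p.2.2)
        (f := fun z : X × Y => (z.1, z.2, 0)) (by fun_prop)
    exact h.measurable.aestronglyMeasurable
  -- The objectives differ by constants independent of `f`, so the minimizers for `L*` serve for `L`
  -- too.
  refine ⟨fP, fD, fun g => ?_, fun n hn ω g => ?_, hmeas, hnorm, hsup, ?_, ?_⟩
  · rw [SVM.isSVM_iff_isSVMStar hL_nonneg hint h0 hlam.le, hfP_iff]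
  · rw [← SVM.isEmpSVM_shiftedLoss_iff, hfD_iff n hn]
  · filter_upwards [hreg] with ω hω
    simp only [fun g : H => (SVM.regRisk_eq_ofReal hL_nonneg (hint g) h0 hlam.le).2]
    exact ENNReal.tendsto_ofReal (hω.add_const _)
  · filter_upwards [hrisk] with ω hω
    simp only [fun g : H => (SVM.risk_eq_ofReal hL_nonneg (hint g) h0).2]
    exact ENNReal.tendsto_ofReal (hω.add_const _)
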